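/- \textbf{Conventions.} A metric space is \emph{geodesic} if any two of its points are joined by an isometrically embedded segment, and \emph{homogeneous} if its isometry group acts transitively. A space $Y$ is \emph{semilocally simply connected} if every $y\in Y$ has a neighbourhood $U$ such that the inclusion-induced homomorphism $\pi_1(U,y)\to\pi_1(Y,y)$ is trivial. Let $\omega$ be an ultrafilter on $\mathbb N$, and let $d=(d_n)$ be a sequence of positive real numbers that is $\omega$-divergent, i.e. $\omega(\{n : d_n>M\})=1$ for every $M$. For a sequence $e=(e_n)$ of points of a metric space $X$, the asymptotic cone $\operatorname{Con}^\omega(X,e,d)$ is the set of sequences $x=(x_n)$ in $X$ for which $\operatorname{dist}(x_n,e_n)/d_n$ is $\omega$-bounded, modulo distance zero, with the metric $\operatorname{dist}(x,y)=\lim^\omega \operatorname{dist}(x_n,y_n)/d_n$. A \emph{partition} $P$ of the closed unit disc $\mathbb D$ is a finite family of topological closed discs $D_1,\dots,D_k$ in the plane with pairwise disjoint interiors, with union $\mathbb D$, and with $D_i\cap D_j=\partial D_i\cap\partial D_j$ for $i\ne j$. Its \emph{vertices} are the points of $\bigcup_i\partial D_i$ that have no neighbourhood in $\bigcup_i\partial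 D_i$ homeomorphic to an interval; its \emph{edges} are the components of $\bigcup_i\partial D_i$ minus the vertices. A \emph{partition} $\Pi$ of a loop $\gamma:\partial\mathbb D\to X$ in a geodesic space $X$ consists of such a $P$ and a map $\Pi$ from its vertices to $X$ that agrees with $\gamma$ at the vertices on $\partial\mathbb D$. Each edge contained in $\partial\mathbb D$ is given the length of the corresponding subpath of $\gamma$, and every other edge the distance between the images of its end points. The \emph{mesh} of $\Pi$ is the maximum over $i$ of the sum of the lengths of the edges in $\partial D_i$. Let $P(\gamma,\delta)\in\mathbb N\cup\{\infty\}$ be the least number $k$ of discs in a partition of $\gamma$ with mesh less than $\delta$ ($\infty$ if there is none). Put $$\vartheta(m)=\sup\{P(\alpha,|\alpha|/2) : \alpha \text{ a loop in } X \text{ with } m-1<|\alpha|\le m\}\qquad(m\in\mathbb N),$$ where $|\alpha|$ is the arc length and the rectifiable loops $\alpha$ are parametrized proportionally to arc length. For $\epsilon>0$, $X$ is \emph{$\epsilon$-coarsely loop divisible with respect to $(\omega,d)$} if for every $\delta\in(0,\epsilon)$ there are a set $A\subseteq\mathbb N$ with $\omega(A)=1$ and a constant $K\in\mathbb N$ such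 that $\vartheta(m)\le K$ for all integers $m\in\bigcup_{n\in A}[\delta d_n,\epsilon d_n]$. \textbf{Proposition.} Let $X$ be a complete homogeneous geodesic metric space, $\omega$ an ultrafilter on $\mathbb N$, $d=(d_n)$ an $\omega$-divergent sequence of positive real numbers, and $e=(e_n)$ a sequence of points of $X$. If $\operatorname{Con}^\omega(X,e,d)$ is semilocally simply connected, then there is an $\epsilon>0$ such that $X$ is $\epsilon$-coarsely loop divisible with respect to $(\omega,d)$. -/

import Mathlib

open Set Filter Topology
open scoped ENNReal NNReal

noncomputable section

namespace CoarseLoop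

/-! ### Metric spaces -/

/-- A geodesic metric space: any two points are joined by an isometrically embedded segment. -/
def IsGeodesicSpace (X : Type*) [MetricSpace X] : Prop :=
  ∀ x y : X, ∃ f : ℝ → X, f 0 = x ∧ f (dist x y) = y ∧
    ∀ s ∈ Icc 0 (dist x y), ∀ t ∈ Icc 0 (dist x y), dist (f s) (f t) = |s - t|

/-- A homogeneous metric space: the isometry group acts transitively. -/
def IsHomogeneousSpace (X : Type*) [MetricSpace X] : Prop :=
  ∀ x y : X, ∃ f : X ≃ᵢ X, f x = y

/-- Every point `x` has a neighbourhood `U` such that the homomorphism from `π₁(U, x)` to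
`π₁(Y, x)` induced by the inclusion is trivial. -/
def IsSemilocallySimplyConnected (Y : Type*) [TopologicalSpace Y] : Prop :=
  ∀ x : Y, ∃ U ∈ 𝓝 x, ∀ p : Path x x, range p ⊆ U → p.Homotopic (Path.refl x)

/-! ### Asymptotic cones -/

/-- A scaling sequence: positive real numbers that diverge `ω`-almost surely. -/
structure ScalingSequence (ω : Ultrafilter ℕ) where
  /-- the terms of the sequence -/
  seq : ℕ → ℝ
  pos : ∀ n, 0 < seq n
  diverges : ∀ M : ℝ, ∀ᶠ n in (ω : Filter ℕ), M < seq n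

/-- The limit of a real sequence along the ultrafilter `ω`. -/
def ultralimit (ω : Ultrafilter ℕ) (c : ℕ → ℝ) : ℝ := limUnder (ω : Filter ℕ) c

theorem tendsto_ultralimit {ω : Ultrafilter ℕ} {c : ℕ → ℝ} {M : ℝ} (h0 : ∀ n, 0 ≤ c n)
    (hM : ∀ᶠ n in (ω : Filter ℕ), c n < M) :
    Tendsto c (ω : Filter ℕ) (𝓝 (ultralimit ω c)) := by
  have h : (ω.map c : Filter ℝ) ≤ 𝓟 (Icc 0 M) := by
    rw [le_principal_iff]
    exact hM.mono fun n hn => ⟨h0 n, hn.le⟩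
  obtain ⟨l, -, hl⟩ := isCompact_Icc.ultrafilter_le_nhds (ω.map c) h
  exact tendsto_nhds_limUnder ⟨l, hl⟩

section Cone

variable {X : Type*} [MetricSpace X] {ω : Ultrafilter ℕ}

/-- The sequences `x` in `X` at finite rescaled distance from the observation sequence `e`. -/
def BoundedSequence (ω : Ultrafilter ℕ) (e : ℕ → X) (d : ScalingSequence ω) : Type _ :=
  {x : ℕ → X // ∃ M : ℝ, ∀ᶠ n in (ω : Filter ℕ), dist (x n) (e n) / d.seq n < M}

theorem BoundedSequence.tendsto_dist {e : ℕ → X} {d : ScalingSequence ω}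
    (x y : BoundedSequence ω e d) :
    Tendsto (fun n => dist (x.1 n) (y.1 n) / d.seq n) (ω : Filter ℕ)
      (𝓝 (ultralimit ω fun n => dist (x.1 n) (y.1 n) / d.seq n)) := by
  obtain ⟨M, hM⟩ := x.2
  obtain ⟨N, hN⟩ := y.2
  refine tendsto_ultralimit (M := M + N) (fun n => div_nonneg dist_nonneg (d.pos n).le) ?_
  filter_upwards [hM, hN] with n h1 h2
  have h3 : dist (x.1 n) (y.1 n) / d.seq n
      ≤ dist (x.1 n) (e n) / d.seq n + dist (y.1 n) (e n) / d.seq n := by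
    rw [← add_div]
    exact div_le_div_of_nonneg_right (dist_triangle_right _ _ _) (d.pos n).le
  linarith

/-- The pseudometric `lim^ω dist (x n) (y n) / d n`. -/
instance (e : ℕ → X) (d : ScalingSequence ω) : PseudoMetricSpace (BoundedSequence ω e d) where
  dist x y := ultralimit ω fun n => dist (x.1 n) (y.1 n) / d.seq n
  dist_self x := by
    have h := BoundedSequence.tendsto_dist x x
    simp only [dist_self, zero_div] at h ⊢
    exact tendsto_nhds_unique h tendsto_const_nhds
  dist_comm x y := by simp only [dist_comm]
  dist_triangle x y z := by
    refine le_of_tendsto_of_tendsto' (BoundedSequence.tendsto_dist x z)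
      ((BoundedSequence.tendsto_dist x y).add (BoundedSequence.tendsto_dist y z)) fun n => ?_
    rw [← add_div]
    exact div_le_div_of_nonneg_right (dist_triangle _ _ _) (d.pos n).le

/-- The asymptotic cone `Con^ω(X, e, d)`: bounded sequences modulo rescaled distance zero, with
the metric `lim^ω dist (x n) (y n) / d n`. -/
abbrev AsymptoticCone (ω : Ultrafilter ℕ) (e : ℕ → X) (d : ScalingSequence ω) : Type _ :=
  SeparationQuotient (BoundedSequence ω e d)

end Cone

/-! ### Partitions of the disc -/

/-- A topological closed disc in the plane. -/
def IsClosedDisc (s : Set ℂ) : Prop := Nonempty (s ≃ₜ Metric.closedBall (0 : ℂ) 1)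

/-- A partition of the unit disc into finitely many closed discs. -/
structure DiscPartition where
  /-- the number of discs -/
  numPieces : ℕ
  /-- the discs -/
  disc : Fin numPieces → Set ℂ
  isClosedDisc : ∀ i, IsClosedDisc (disc i)
  disjoint_interior : ∀ i j, i ≠ j → Disjoint (interior (disc i)) (interior (disc j))
  iUnion_disc : ⋃ i, disc i = Metric.closedBall 0 1
  inter_disc : ∀ i j, i ≠ j → disc i ∩ disc j = frontier (disc i) ∩ frontier (disc j)

namespace DiscPartition

variable (P : DiscPartition)

/-- The union of the boundaries of the discs. -/
def skeleton : Set ℂ := ⋃ i, frontier (P.disc i)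

/-- The points of the skeleton without a neighbourhood in the skeleton that is homeomorphic to an
interval. -/
def vertices : Set ℂ :=
  {p | p ∈ P.skeleton ∧ ∀ U : Set ℂ, IsOpen U → p ∈ U →
    ¬ ∃ I : Set ℝ, I.OrdConnected ∧ Nonempty (↥(U ∩ P.skeleton) ≃ₜ I)}

/-- The (open) edges: the components of the skeleton with the vertices removed. Apart from the
trivial partition, whose only edge is the unit circle and which has no vertex, each of them is an
open arc that joins two adjacent vertices. -/
def edges : Set (Set ℂ) :=
  {E | ∃ x ∈ P.skeleton \ P.vertices, E = connectedComponentIn (P.skeleton \ P.vertices) x}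

end DiscPartition

/-! ### Partitions of loops -/

section Loops

variable {X : Type*} [MetricSpace X]

/-- The arc length `|γ|` of a loop. -/
def loopLength (γ : C(Circle, X)) : ℝ≥0∞ :=
  eVariationOn (fun t : ℝ => γ (Circle.exp t)) (Icc 0 (2 * Real.pi))

/-- The loop is rectifiable and parametrized proportionally to arc length. -/
def IsProportionalToArcLength (γ : C(Circle, X)) : Prop :=
  ∃ l : ℝ≥0, HasConstantSpeedOnWith (fun t : ℝ => γ (Circle.exp t)) univ l

/-- The arc length of the subpath of `γ` over an open arc `E` of the unit circle (or over the whole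
circle): the supremum over the parameter intervals, going around at most once, whose interior is
mapped into `E`. -/
def arcLengthOver (γ : C(Circle, X)) (E : Set ℂ) : ℝ≥0∞ :=
  ⨆ (a : ℝ) (b : ℝ) (_ : a ≤ b ∧ b ≤ a + 2 * Real.pi ∧
    ∀ t ∈ Ioo a b, (Circle.exp t : ℂ) ∈ E),
    eVariationOn (fun t : ℝ => γ (Circle.exp t)) (Icc a b)

/-- A partition of the loop `γ`: a map from the vertices of a partition of the disc to `X` that
agrees with `γ` on the unit circle. -/
structure LoopPartition (γ : C(Circle, X)) where
  /-- the underlying partition of the disc -/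
  base : DiscPartition
  /-- the images of the vertices -/
  toFun : base.vertices → X
  agrees : ∀ (v : base.vertices) (z : Circle), (z : ℂ) = v → toFun v = γ z

namespace LoopPartition

variable {γ : C(Circle, X)} (Q : LoopPartition γ)

open Classical in
/-- The length of an edge: an edge in the unit circle is mapped to the corresponding subpath of
`γ`, and any other edge to a geodesic between the images of its end points, whose length is their
distance. -/
def edgeLength (E : Set ℂ) : ℝ≥0∞ :=
  if E ⊆ Metric.sphere (0 : ℂ) 1 then arcLengthOver γ E
  else Metric.ediam (Q.toFun '' {v | (v : ℂ) ∈ closure E})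

/-- The arc length of the image of the boundary of the `i`-th disc: the sum of the lengths of its
edges. -/
def pieceLength (i : Fin Q.base.numPieces) : ℝ≥0∞ :=
  ∑' E : {E : Set ℂ // E ∈ Q.base.edges ∧ E ⊆ frontier (Q.base.disc i)}, Q.edgeLength E

/-- The maximal length of a piece. -/
def mesh : ℝ≥0∞ := ⨆ i, Q.pieceLength i

end LoopPartition

/-- `P(γ, δ)`: the minimal number of pieces in a partition of `γ` with mesh less than `δ`, and
`⊤` if there is none. -/
def minPieces (γ : C(Circle, X)) (δ : ℝ≥0∞) : ℕ∞ :=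
  ⨅ (Q : LoopPartition γ) (_ : Q.mesh < δ), (Q.base.numPieces : ℕ∞)

end Loops

/-! ### Coarse loop divisibility -/

section Divisibility

variable (X : Type*) [MetricSpace X]

/-- The divisibility function `ϑ(n)`: the supremum of `P(α, |α| / 2)` over the loops `α` in `X`
with `n - 1 < |α| ≤ n`, parametrized proportionally to arc length. -/
def divisibility (n : ℕ) : ℕ∞ :=
  ⨆ (α : C(Circle, X)) (_ : IsProportionalToArcLength α ∧
    (n : ℝ≥0∞) < loopLength α + 1 ∧ loopLength α ≤ n), minPieces α (loopLength α / 2)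

/-- `X` is `ε`-coarsely loop divisible with respect to `(ω, d)`. -/
def IsCoarselyLoopDivisible (ω : Ultrafilter ℕ) (d : ScalingSequence ω) (ε : ℝ) : Prop :=
  ∀ δ ∈ Ioo 0 ε, ∃ A ∈ ω, ∃ K : ℕ, ∀ n ∈ A, ∀ m : ℕ,
    (m : ℝ) ∈ Icc (δ * d.seq n) (ε * d.seq n) → divisibility X m ≤ K

end Divisibility

end CoarseLoop

end

noncomputable section

namespace CoarseLoop

/-! ### Grid partitions of the disc -/

/-! Semilocal simple connectivity at the class of `e` gives an `r > 0` such that every loop based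
there and staying within distance `r` is null-homotopic in the cone; `ε = r` works. If it failed for
some `δ`, then for every `K` and `ω`-almost every `n` some loop of length between `δ d_n - 1` and `r
d_n` would need more than `K` pieces. `exists_extremal_loop` selects one loop `α_n` per index, bad
for all such `K ≤ n` at once; this is needed because the number of pieces that gives the
contradiction is known only after passing to the limit.

Homogeneity moves `α_n` to a loop `β_n` based at `e_n`. The rescaled `β_n` are uniformly Lipschitz,
so they converge to a loop in the cone within distance `r` of its base point, and this loop bounds a
disc (`exists_disc_in_cone`). Subdivide the disc by an `N × N` grid so fine that each cell has small
image. Only finitely many grid points are involved, so lifting them to `X` keeps neighbours close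
for `ω`-most `n` (`exists_grid_approximation`). This partitions `α_n` into `N * N` pieces of mesh
below `|α_n| / 2` (`exists_loopPartition_mesh_le`), a contradiction once `n ≥ N * N`. -/

/-- A homeomorphism of the plane that maps a given rectangle onto the unit disc. -/
theorem exists_homeomorph_image_rectangle {a b c d : ℝ} (hab : a < b) (hcd : c < d) :
    ∃ h : ℂ ≃ₜ ℂ, h '' (Icc a b ×ℂ Icc c d) = Metric.closedBall 0 1 := by
  have hconv : Convex ℝ (Icc a b ×ℂ Icc c d) :=
    ((convex_Icc a b).linear_preimage Complex.reLm).inter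
      ((convex_Icc c d).linear_preimage Complex.imLm)
  have hint : (interior (Icc a b ×ℂ Icc c d)).Nonempty := by
    rw [Complex.interior_reProdIm, interior_Icc, interior_Icc]
    obtain ⟨x, hx⟩ := nonempty_Ioo.2 hab
    obtain ⟨y, hy⟩ := nonempty_Ioo.2 hcd
    exact ⟨⟨x, y⟩, hx, hy⟩
  obtain ⟨h, -, hh, -⟩ := exists_homeomorph_image_interior_closure_frontier_eq_unitBall hconv hint
    ((Metric.isBounded_Icc a b).reProdIm (Metric.isBounded_Icc c d))
  rw [(isClosed_Icc.reProdIm isClosed_Icc).closure_eq] at hh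
  exact ⟨h, hh⟩

/-- The unit square with lower left corner `(i, j)`. -/
def gridCell (i j : ℕ) : Set ℂ := Icc (i : ℝ) (i + 1) ×ℂ Icc (j : ℝ) (j + 1)

theorem interior_gridCell (i j : ℕ) :
    interior (gridCell i j) = Ioo (i : ℝ) (i + 1) ×ℂ Ioo (j : ℝ) (j + 1) := by
  rw [gridCell, Complex.interior_reProdIm, interior_Icc, interior_Icc]

theorem isClosed_gridCell (i j : ℕ) : IsClosed (gridCell i j) :=
  isClosed_Icc.reProdIm isClosed_Icc

theorem closure_interior_gridCell (i j : ℕ) :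
    closure (interior (gridCell i j)) = gridCell i j := by
  rw [interior_gridCell, Complex.closure_reProdIm, closure_Ioo (by simp), closure_Ioo (by simp),
    gridCell]

theorem mem_frontier_gridCell {i j : ℕ} {z : ℂ} :
    z ∈ frontier (gridCell i j) ↔
      (z.re ∈ Icc (i : ℝ) (i + 1) ∧ (z.im = j ∨ z.im = j + 1)) ∨
        ((z.re = i ∨ z.re = i + 1) ∧ z.im ∈ Icc (j : ℝ) (j + 1)) := by
  rw [gridCell, Complex.frontier_reProdIm, frontier_Icc (by simp), frontier_Icc (by simp),
    closure_Icc, closure_Icc]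
  simp [Complex.mem_reProdIm]

theorem eq_of_mem_Ioo_of_mem_Ioo {i j : ℕ} {x : ℝ} (hi : x ∈ Ioo (i : ℝ) (i + 1))
    (hj : x ∈ Ioo (j : ℝ) (j + 1)) : i = j := by
  have h1 : (i : ℝ) < j + 1 := hi.1.trans hj.2
  have h2 : (j : ℝ) < i + 1 := hj.1.trans hi.2
  have h1' : i < j + 1 := by exact_mod_cast h1
  have h2' : j < i + 1 := by exact_mod_cast h2
  omega

theorem disjoint_interior_gridCell {i j i' j' : ℕ} (h : (i, j) ≠ (i', j')) :
    Disjoint (interior (gridCell i j)) (interior (gridCell i' j')) := by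
  rw [interior_gridCell, interior_gridCell, Set.disjoint_left]
  intro z hz hz'
  exact h (Prod.ext (eq_of_mem_Ioo_of_mem_Ioo hz.1 hz'.1) (eq_of_mem_Ioo_of_mem_Ioo hz.2 hz'.2))

/-- An open set disjoint from `interior t` is disjoint from its closure `t`, so a common point lies
in neither interior. -/
theorem inter_eq_frontier_inter_frontier {Y : Type*} [TopologicalSpace Y] {s t : Set Y}
    (hs : closure (interior s) = s) (ht : closure (interior t) = t)
    (h : Disjoint (interior s) (interior t)) : s ∩ t = frontier s ∩ frontier t := by
  have hsc : IsClosed s := hs ▸ isClosed_closure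
  have htc : IsClosed t := ht ▸ isClosed_closure
  refine Subset.antisymm ?_ (inter_subset_inter hsc.frontier_subset htc.frontier_subset)
  rintro x ⟨hx, hx'⟩
  have h1 : Disjoint (interior s) t := ht ▸ h.closure_right isOpen_interior
  have h2 : Disjoint s (interior t) := hs ▸ h.closure_left isOpen_interior
  rw [hsc.frontier_eq, htc.frontier_eq]
  exact ⟨⟨hx, fun hi => Set.disjoint_left.1 h1 hi hx'⟩,
    ⟨hx', fun hi => Set.disjoint_left.1 h2 hx hi⟩⟩

theorem exists_nat_mem_Icc {N : ℕ} (hN : 0 < N) {x : ℝ} (hx : x ∈ Icc (0 : ℝ) N) :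
    ∃ i < N, x ∈ Icc (i : ℝ) (i + 1) := by
  rcases hx.2.lt_or_eq with h | h
  · exact ⟨⌊x⌋₊, (Nat.floor_lt hx.1).2 h, Nat.floor_le hx.1, (Nat.lt_floor_add_one x).le⟩
  -- The right end point `x = N` belongs to the last interval, not to the one starting at its floor.
  · refine ⟨N - 1, by omega, ?_⟩
    have : ((N - 1 : ℕ) : ℝ) = N - 1 := by push_cast [Nat.one_le_iff_ne_zero.2 hN.ne']; ring
    rw [this, h]
    constructor <;> linarith

theorem iUnion_gridCell {N : ℕ} (hN : 0 < N) :
    ⋃ k : Fin N × Fin N, gridCell k.1 k.2 = Icc (0 : ℝ) N ×ℂ Icc (0 : ℝ) N := by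
  have key : ∀ i : Fin N, Icc ((i : ℕ) : ℝ) ((i : ℕ) + 1) ⊆ Icc (0 : ℝ) N := fun i =>
    Icc_subset_Icc (Nat.cast_nonneg _) (by exact_mod_cast i.2)
  refine Subset.antisymm (iUnion_subset fun k z hz => ⟨key _ hz.1, key _ hz.2⟩) ?_
  rintro z ⟨h1, h2⟩
  obtain ⟨i, hi, hi'⟩ := exists_nat_mem_Icc hN h1
  obtain ⟨j, hj, hj'⟩ := exists_nat_mem_Icc hN h2
  exact mem_iUnion.2 ⟨(⟨i, hi⟩, ⟨j, hj⟩), hi', hj'⟩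

section Grid

variable {N : ℕ} (hN : 0 < N) (Ψ : ℂ ≃ₜ ℂ)
  (hΨ : Ψ '' (Icc (0 : ℝ) N ×ℂ Icc (0 : ℝ) N) = Metric.closedBall 0 1)

/-- The partition of the disc into the images of the cells of an `N × N` grid under a
homeomorphism that maps the square onto the disc. -/
def gridPartition : DiscPartition where
  numPieces := N * N
  disc k := Ψ '' gridCell (finProdFinEquiv.symm k).1 (finProdFinEquiv.symm k).2
  isClosedDisc k := by
    obtain ⟨h, hh⟩ := exists_homeomorph_image_rectangle
      (lt_add_one (((finProdFinEquiv.symm k).1 : ℕ) : ℝ))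
      (lt_add_one (((finProdFinEquiv.symm k).2 : ℕ) : ℝ))
    exact ⟨(Ψ.image _).symm.trans ((h.image _).trans (Homeomorph.setCongr hh))⟩
  disjoint_interior k l hkl := by
    rw [← Ψ.image_interior, ← Ψ.image_interior, disjoint_image_iff Ψ.injective]
    refine disjoint_interior_gridCell fun h => hkl (finProdFinEquiv.symm.injective ?_)
    rw [Prod.ext_iff] at h
    exact Prod.ext (Fin.ext h.1) (Fin.ext h.2)
  iUnion_disc := by
    rw [← image_iUnion, ← hΨ, ← iUnion_gridCell hN]
    congr 1
    exact finProdFinEquiv.symm.surjective.iUnion_comp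
      fun k : Fin N × Fin N => gridCell (k.1 : ℕ) (k.2 : ℕ)
  inter_disc k l hkl := by
    refine inter_eq_frontier_inter_frontier ?_ ?_ ?_
    · rw [← Ψ.image_interior, ← Ψ.image_closure, closure_interior_gridCell]
    · rw [← Ψ.image_interior, ← Ψ.image_closure, closure_interior_gridCell]
    · rw [← Ψ.image_interior, ← Ψ.image_interior, disjoint_image_iff Ψ.injective]
      refine disjoint_interior_gridCell fun h => hkl (finProdFinEquiv.symm.injective ?_)
      rw [Prod.ext_iff] at h
      exact Prod.ext (Fin.ext h.1) (Fin.ext h.2)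

theorem gridPartition_skeleton : (gridPartition hN Ψ hΨ).skeleton =
    Ψ '' ⋃ k : Fin N × Fin N, frontier (gridCell k.1 k.2) := by
  rw [image_iUnion, DiscPartition.skeleton]
  simp only [gridPartition, ← Ψ.image_frontier]
  exact finProdFinEquiv.symm.surjective.iUnion_comp
      fun k : Fin N × Fin N => Ψ '' frontier (gridCell (k.1 : ℕ) (k.2 : ℕ))

/-- A point of the skeleton that lies on an open arc which is open in the skeleton is not a
vertex. -/
theorem DiscPartition.notMem_vertices (P : DiscPartition) {p : ℂ} {U : Set ℂ} {f : ℝ → ℂ}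
    {I : Set ℝ} (hU : IsOpen U) (hp : p ∈ U) (hf : IsEmbedding f) (hI : I.OrdConnected)
    (h : U ∩ P.skeleton = f '' I) : p ∉ P.vertices := fun hv =>
  hv.2 U hU hp ⟨I, hI, ⟨(Homeomorph.setCongr h).trans (hf.homeomorphImage I).symm⟩⟩

theorem isEmbedding_mk_left (x : ℝ) : IsEmbedding fun t : ℝ => (⟨x, t⟩ : ℂ) :=
  .of_comp (g := Complex.im) (by
    have : (fun t : ℝ => (⟨x, t⟩ : ℂ)) = fun t : ℝ => (x : ℂ) + t * Complex.I := by
      funext t; exact (Complex.mk_eq_add_mul_I x t)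
    rw [this]; fun_prop) Complex.continuous_im IsEmbedding.id

theorem isEmbedding_mk_right (y : ℝ) : IsEmbedding fun t : ℝ => (⟨t, y⟩ : ℂ) :=
  .of_comp (g := Complex.re) (by
    have : (fun t : ℝ => (⟨t, y⟩ : ℂ)) = fun t : ℝ => (t : ℂ) + y * Complex.I := by
      funext t; exact (Complex.mk_eq_add_mul_I t y)
    rw [this]; fun_prop) Complex.continuous_re IsEmbedding.id

theorem nat_notMem_Ioo (i j : ℕ) : (i : ℝ) ∉ Ioo (j : ℝ) (j + 1) := by
  rintro ⟨h1, h2⟩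
  have h1' : j < i := by exact_mod_cast h1
  have h2' : i < j + 1 := by exact_mod_cast h2
  omega

theorem nat_eq_of_mem_Ioo {i j : ℕ} (h : (i : ℝ) ∈ Ioo ((j : ℝ) - 1) (j + 1)) : i = j := by
  have h1 : (j : ℝ) < i + 1 := by linarith [h.1]
  have h1' : j < i + 1 := by exact_mod_cast h1
  have h2' : i < j + 1 := by exact_mod_cast h.2
  omega

theorem exists_nat_of_mem_frontier_gridCell {i j : ℕ} {z : ℂ} (h : z ∈ frontier (gridCell i j)) :
    (∃ k : ℕ, z.re = k) ∨ ∃ k : ℕ, z.im = k := by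
  rcases mem_frontier_gridCell.1 h with ⟨-, h | h⟩ | ⟨h | h, -⟩
  · exact .inr ⟨j, h⟩
  · exact .inr ⟨j + 1, by simpa using h⟩
  · exact .inl ⟨i, h⟩
  · exact .inl ⟨i + 1, by simpa using h⟩

/-- The box `(k - 1, k + 1) × (j, j + 1)` meets no grid line other than `re = k`, so near the point
the skeleton is an open arc. This covers sides on the boundary of the square as well. -/
theorem vertical_side_notMem_vertices {k j : ℕ} {y : ℝ} (hy : y ∈ Ioo (j : ℝ) (j + 1))
    {i : Fin N} {j' : Fin N} (hj : (j' : ℕ) = j) (hk : k = i ∨ k = i + 1) :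
    Ψ ⟨k, y⟩ ∉ (gridPartition hN Ψ hΨ).vertices := by
  refine DiscPartition.notMem_vertices _
    (U := Ψ '' (Ioo ((k : ℝ) - 1) (k + 1) ×ℂ Ioo (j : ℝ) (j + 1)))
    (f := Ψ ∘ fun t => ⟨k, t⟩) (I := Ioo (j : ℝ) (j + 1))
    (Ψ.isOpenMap _ (isOpen_Ioo.reProdIm isOpen_Ioo))
    (mem_image_of_mem _ ⟨by simp, hy⟩) (Ψ.isEmbedding.comp (isEmbedding_mk_left _)) ordConnected_Ioo
    ?_
  rw [gridPartition_skeleton, ← image_inter Ψ.injective, image_comp]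
  congr 1
  ext z
  constructor
  · rintro ⟨⟨h1, h2⟩, h⟩
    obtain ⟨c, hc⟩ := mem_iUnion.1 h
    rcases exists_nat_of_mem_frontier_gridCell hc with ⟨l, hl⟩ | ⟨l, hl⟩
    · have : l = k := nat_eq_of_mem_Ioo (hl ▸ h1)
      exact ⟨z.im, h2, Complex.ext (by simp [hl, this]) rfl⟩
    · exact (nat_notMem_Ioo l j (hl ▸ h2)).elim
  · rintro ⟨t, ht, rfl⟩
    refine ⟨⟨by simp, ht⟩, mem_iUnion.2 ⟨(i, j'), mem_frontier_gridCell.2 (.inr ⟨?_, ?_⟩)⟩⟩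
    · rcases hk with rfl | rfl
      · exact .inl rfl
      · exact .inr (by simp)
    · rw [hj]; exact Ioo_subset_Icc_self ht

theorem horizontal_side_notMem_vertices {k i : ℕ} {x : ℝ} (hx : x ∈ Ioo (i : ℝ) (i + 1))
    {i' : Fin N} {j : Fin N} (hi : (i' : ℕ) = i) (hk : k = j ∨ k = j + 1) :
    Ψ ⟨x, k⟩ ∉ (gridPartition hN Ψ hΨ).vertices := by
  refine DiscPartition.notMem_vertices _
    (U := Ψ '' (Ioo (i : ℝ) (i + 1) ×ℂ Ioo ((k : ℝ) - 1) (k + 1)))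
    (f := Ψ ∘ fun t => ⟨t, k⟩) (I := Ioo (i : ℝ) (i + 1))
    (Ψ.isOpenMap _ (isOpen_Ioo.reProdIm isOpen_Ioo))
    (mem_image_of_mem _ ⟨hx, by simp⟩) (Ψ.isEmbedding.comp (isEmbedding_mk_right _))
    ordConnected_Ioo ?_
  rw [gridPartition_skeleton, ← image_inter Ψ.injective, image_comp]
  congr 1
  ext z
  constructor
  · rintro ⟨⟨h1, h2⟩, h⟩
    obtain ⟨c, hc⟩ := mem_iUnion.1 h
    rcases exists_nat_of_mem_frontier_gridCell hc with ⟨l, hl⟩ | ⟨l, hl⟩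
    · exact (nat_notMem_Ioo l i (hl ▸ h1)).elim
    · have : l = k := nat_eq_of_mem_Ioo (hl ▸ h2)
      exact ⟨z.re, h1, Complex.ext rfl (by simp [hl, this])⟩
  · rintro ⟨t, ht, rfl⟩
    refine ⟨⟨ht, by simp⟩, mem_iUnion.2 ⟨(i', j), mem_frontier_gridCell.2 (.inl ⟨?_, ?_⟩)⟩⟩
    · rw [hi]; exact Ioo_subset_Icc_self ht
    · rcases hk with rfl | rfl
      · exact .inl rfl
      · exact .inr (by simp)

/-- The four corners and the four open sides of a unit square. -/
def gridSide (i j : ℕ) : Fin 3 × Fin 3 → Set ℂ := fun k =>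
  (![{(i : ℝ)}, Ioo (i : ℝ) (i + 1), {(i : ℝ) + 1}] k.1) ×ℂ
    (![{(j : ℝ)}, Ioo (j : ℝ) (j + 1), {(j : ℝ) + 1}] k.2)

theorem exists_mem_triple {i : ℕ} {x : ℝ} (h : x ∈ Icc (i : ℝ) (i + 1)) :
    ∃ k : Fin 3, x ∈ (![{(i : ℝ)}, Ioo (i : ℝ) (i + 1), {(i : ℝ) + 1}] k : Set ℝ) := by
  rcases h.1.eq_or_lt with h1 | h1
  · exact ⟨0, h1.symm⟩
  rcases h.2.eq_or_lt with h2 | h2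
  · exact ⟨2, h2⟩
  · exact ⟨1, h1, h2⟩

/-- The integer points of the square. -/
def gridPoints (N : ℕ) : Set ℂ :=
  {z | (∃ k ∈ Finset.range (N + 1), z.re = k) ∧ ∃ k ∈ Finset.range (N + 1), z.im = k}

theorem finite_gridPoints (N : ℕ) : (gridPoints N).Finite := by
  refine ((Finset.range (N + 1) ×ˢ Finset.range (N + 1)).finite_toSet.image
    fun k : ℕ × ℕ => (⟨k.1, k.2⟩ : ℂ)).subset ?_
  rintro z ⟨⟨k, hk, hk'⟩, l, hl, hl'⟩
  exact ⟨(k, l), Finset.mem_coe.2 (Finset.mk_mem_product hk hl), Complex.ext hk'.symm hl'.symm⟩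

/-- Only the inclusion is needed, and it is strict in general: the corners of the square are not
vertices, since the skeleton is an arc near their images. -/
theorem gridPartition_vertices_subset :
    (gridPartition hN Ψ hΨ).vertices ⊆ Ψ '' gridPoints N := by
  intro p hp
  have hp' := hp.1
  rw [gridPartition_skeleton] at hp'
  obtain ⟨z, hz, rfl⟩ := hp'
  obtain ⟨⟨i, j⟩, h⟩ := mem_iUnion.1 hz
  refine mem_image_of_mem _ ?_
  have hi := i.2
  have hj := j.2
  rcases mem_frontier_gridCell.1 h with ⟨h1, h2⟩ | ⟨h1, h2⟩
  · obtain ⟨k, hk, hk'⟩ : ∃ k : ℕ, (k = j ∨ k = j + 1) ∧ z.im = k := by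
      rcases h2 with h2 | h2
      · exact ⟨j, .inl rfl, h2⟩
      · exact ⟨j + 1, .inr rfl, by simpa using h2⟩
    refine ⟨?_, k, by simp; omega, hk'⟩
    rcases h1.1.eq_or_lt with h3 | h3
    · exact ⟨i, by simp, h3.symm⟩
    rcases h1.2.eq_or_lt with h4 | h4
    · exact ⟨i + 1, by simp, by simpa using h4⟩
    · refine (horizontal_side_notMem_vertices hN Ψ hΨ ⟨h3, h4⟩ rfl hk ?_).elim
      rw [← hk']; exact hp
  · obtain ⟨k, hk, hk'⟩ : ∃ k : ℕ, (k = i ∨ k = i + 1) ∧ z.re = k := by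
      rcases h1 with h1 | h1
      · exact ⟨i, .inl rfl, h1⟩
      · exact ⟨i + 1, .inr rfl, by simpa using h1⟩
    refine ⟨⟨k, by simp; omega, hk'⟩, ?_⟩
    rcases h2.1.eq_or_lt with h3 | h3
    · exact ⟨j, by simp, h3.symm⟩
    rcases h2.2.eq_or_lt with h4 | h4
    · exact ⟨j + 1, by simp, by simpa using h4⟩
    · refine (vertical_side_notMem_vertices hN Ψ hΨ ⟨h3, h4⟩ rfl hk ?_).elim
      rw [← hk']; exact hp

/-- An open side is connected and contains no vertex, so it lies in a single edge; a corner is a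
single point. -/
theorem gridPartition_edge_eq {i j : Fin N} {k : Fin 3 × Fin 3} {z w : ℂ}
    (hz : z ∈ frontier (gridCell i j)) (hzk : z ∈ gridSide i j k) (hwk : w ∈ gridSide i j k) :
    connectedComponentIn
        ((gridPartition hN Ψ hΨ).skeleton \ (gridPartition hN Ψ hΨ).vertices) (Ψ z) =
      connectedComponentIn
        ((gridPartition hN Ψ hΨ).skeleton \ (gridPartition hN Ψ hΨ).vertices) (Ψ w) := by
  obtain ⟨k, l⟩ := k
  have hfr : ∀ v ∈ frontier (gridCell i j), Ψ v ∈ (gridPartition hN Ψ hΨ).skeleton := by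
    intro v hv
    rw [gridPartition_skeleton]
    exact mem_image_of_mem _ (mem_iUnion.2 ⟨(i, j), hv⟩)
  have vert : ∀ k : ℕ, (k = i ∨ k = i + 1) → z ∈ {(k : ℝ)} ×ℂ Ioo (j : ℝ) (j + 1) →
      w ∈ {(k : ℝ)} ×ℂ Ioo (j : ℝ) (j + 1) →
      connectedComponentIn
        ((gridPartition hN Ψ hΨ).skeleton \ (gridPartition hN Ψ hΨ).vertices) (Ψ z) =
      connectedComponentIn
        ((gridPartition hN Ψ hΨ).skeleton \ (gridPartition hN Ψ hΨ).vertices) (Ψ w) := by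
    intro k hk hz hw
    have hpre : IsPreconnected ((Ψ ∘ fun t : ℝ => (⟨k, t⟩ : ℂ)) '' Ioo (j : ℝ) (j + 1)) :=
      isPreconnected_Ioo.image _ (Ψ.continuous.comp (isEmbedding_mk_left _).continuous).continuousOn
    have hsub : (Ψ ∘ fun t : ℝ => (⟨k, t⟩ : ℂ)) '' Ioo (j : ℝ) (j + 1) ⊆
        (gridPartition hN Ψ hΨ).skeleton \ (gridPartition hN Ψ hΨ).vertices := by
      rintro _ ⟨t, ht, rfl⟩
      refine ⟨hfr _ (mem_frontier_gridCell.2 (.inr ⟨?_, Ioo_subset_Icc_self ht⟩)),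
        vertical_side_notMem_vertices hN Ψ hΨ ht rfl hk⟩
      rcases hk with rfl | rfl
      · exact .inl rfl
      · exact .inr (by simp)
    have hmem : ∀ v ∈ {(k : ℝ)} ×ℂ Ioo (j : ℝ) (j + 1),
        Ψ v ∈ (Ψ ∘ fun t : ℝ => (⟨k, t⟩ : ℂ)) '' Ioo (j : ℝ) (j + 1) := fun v hv =>
      ⟨v.im, hv.2, congrArg Ψ (Complex.ext hv.1.symm rfl)⟩
    exact connectedComponentIn_eq (hpre.subset_connectedComponentIn (hmem z hz) hsub (hmem w hw))
  have horz : ∀ k : ℕ, (k = j ∨ k = j + 1) → z ∈ Ioo (i : ℝ) (i + 1) ×ℂ {(k : ℝ)} →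
      w ∈ Ioo (i : ℝ) (i + 1) ×ℂ {(k : ℝ)} →
      connectedComponentIn
        ((gridPartition hN Ψ hΨ).skeleton \ (gridPartition hN Ψ hΨ).vertices) (Ψ z) =
      connectedComponentIn
        ((gridPartition hN Ψ hΨ).skeleton \ (gridPartition hN Ψ hΨ).vertices) (Ψ w) := by
    intro k hk hz hw
    have hpre : IsPreconnected ((Ψ ∘ fun t : ℝ => (⟨t, k⟩ : ℂ)) '' Ioo (i : ℝ) (i + 1)) :=
      isPreconnected_Ioo.image _
        (Ψ.continuous.comp (isEmbedding_mk_right _).continuous).continuousOn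
    have hsub : (Ψ ∘ fun t : ℝ => (⟨t, k⟩ : ℂ)) '' Ioo (i : ℝ) (i + 1) ⊆
        (gridPartition hN Ψ hΨ).skeleton \ (gridPartition hN Ψ hΨ).vertices := by
      rintro _ ⟨t, ht, rfl⟩
      refine ⟨hfr _ (mem_frontier_gridCell.2 (.inl ⟨Ioo_subset_Icc_self ht, ?_⟩)),
        horizontal_side_notMem_vertices hN Ψ hΨ ht rfl hk⟩
      rcases hk with rfl | rfl
      · exact .inl rfl
      · exact .inr (by simp)
    have hmem : ∀ v ∈ Ioo (i : ℝ) (i + 1) ×ℂ {(k : ℝ)},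
        Ψ v ∈ (Ψ ∘ fun t : ℝ => (⟨t, k⟩ : ℂ)) '' Ioo (i : ℝ) (i + 1) := fun v hv =>
      ⟨v.re, hv.1, congrArg Ψ (Complex.ext rfl hv.2.symm)⟩
    exact connectedComponentIn_eq (hpre.subset_connectedComponentIn (hmem z hz) hsub (hmem w hw))
  have corner : ∀ x y : ℝ, z ∈ {x} ×ℂ {y} → w ∈ {x} ×ℂ {y} → z = w := fun x y hz hw =>
    Complex.ext (hz.1.trans hw.1.symm) (hz.2.trans hw.2.symm)
  fin_cases k <;> fin_cases l
  · rw [corner _ _ hzk hwk]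
  · exact vert i (.inl rfl) hzk hwk
  · rw [corner _ _ hzk hwk]
  · exact horz j (.inl rfl) hzk hwk
  -- The index `(1, 1)` of `gridSide` is the open cell, which misses the frontier.
  · rw [(isClosed_gridCell _ _).frontier_eq, interior_gridCell] at hz
    exact (hz.2 hzk).elim
  · refine horz (j + 1) (.inr rfl) ?_ ?_ <;> simpa [gridSide] using by assumption
  · rw [corner _ _ hzk hwk]
  · refine vert (i + 1) (.inr rfl) ?_ ?_ <;> simpa [gridSide] using by assumption
  · rw [corner _ _ hzk hwk]

/-- Each edge on the boundary of a cell meets one of the nine strata `gridSide`, and edges meeting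
the same stratum coincide. Corners are counted because a corner need not be a vertex. The bound is
not sharp, but any bound independent of `N` suffices. -/
theorem card_edges_gridPartition_le (i : Fin (gridPartition hN Ψ hΨ).numPieces) :
    ENat.card {E : Set ℂ // E ∈ (gridPartition hN Ψ hΨ).edges ∧
      E ⊆ frontier ((gridPartition hN Ψ hΨ).disc i)} ≤ 9 := by
  obtain ⟨⟨a, b⟩, rfl⟩ := finProdFinEquiv.surjective i
  have hdisc : (gridPartition hN Ψ hΨ).disc (finProdFinEquiv (a, b)) = Ψ '' gridCell a b := by
    simp [gridPartition]
  have h : ∀ E : {E : Set ℂ // E ∈ (gridPartition hN Ψ hΨ).edges ∧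
      E ⊆ frontier ((gridPartition hN Ψ hΨ).disc (finProdFinEquiv (a, b)))},
      ∃ k : Fin 3 × Fin 3, ∃ z : ℂ, z ∈ frontier (gridCell a b) ∧ z ∈ gridSide a b k ∧
        E.1 = connectedComponentIn
          ((gridPartition hN Ψ hΨ).skeleton \ (gridPartition hN Ψ hΨ).vertices) (Ψ z) := by
    rintro ⟨E, ⟨x, hx, hE⟩, hEi⟩
    have hxE : x ∈ E := hE ▸ mem_connectedComponentIn hx
    have hxi := hEi hxE
    rw [hdisc, ← Ψ.image_frontier] at hxi
    obtain ⟨z, hz, rfl⟩ := hxi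
    have hz' := (isClosed_gridCell _ _).frontier_subset hz
    obtain ⟨k, hk⟩ := exists_mem_triple hz'.1
    obtain ⟨l, hl⟩ := exists_mem_triple hz'.2
    exact ⟨(k, l), z, hz, ⟨hk, hl⟩, hE⟩
  choose k z h1 h2 h3 using h
  have hinj : Function.Injective k := fun E E' hk => Subtype.ext <| by
    rw [h3, h3]
    exact gridPartition_edge_eq hN Ψ hΨ (h1 E) (h2 E) (hk ▸ h2 E')
  simpa using ENat.card_le_card_of_injective hinj

end Grid

/-! ### Loop partitions over grids -/

theorem dist_circleExp (s t : ℝ) :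
    dist (Circle.exp s : ℂ) (Circle.exp t) = 2 * |Real.sin ((s - t) / 2)| := by
  have h : (Circle.exp s : ℂ) - Circle.exp t =
      Circle.exp t * (Complex.exp (Complex.I * (s - t : ℝ)) - 1) := by
    rw [Circle.coe_exp, Circle.coe_exp, mul_sub, ← Complex.exp_add]
    push_cast
    ring_nf
  rw [dist_eq_norm, h, norm_mul, Circle.norm_coe, one_mul, Complex.norm_exp_I_mul_ofReal_sub_one,
    norm_mul, Real.norm_eq_abs, Real.norm_eq_abs, abs_two]

/-- An arc of the circle of diameter at most `r < 2` has length at most `π * r / 2`. -/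
theorem arc_length_le_of_dist_le {a b r : ℝ} (hr0 : 0 ≤ r) (hr : r < 2)
    (h : ∀ s ∈ Ioo a b, ∀ t ∈ Ioo a b, dist (Circle.exp s : ℂ) (Circle.exp t) ≤ r) :
    b - a ≤ Real.pi * r / 2 := by
  by_contra! hlt
  have hπ := Real.pi_pos
  -- Here `r < 2` is used. Two parameters at distance `u` in this range, centred in the interval,
  -- span a chord `2 sin (u / 2)`, which by Jordan's inequality is at least `2u / π > r`.
  have h1 : Real.pi * r / 2 < min (b - a) Real.pi := lt_min hlt (by nlinarith)
  obtain ⟨u, hu1, hu2⟩ := exists_between h1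
  have hu0 : 0 ≤ u := le_trans (by positivity) hu1.le
  have hub := hu2.trans_le (min_le_left _ _)
  have huπ := hu2.trans_le (min_le_right _ _)
  have h2 := h ((a + b + u) / 2) ⟨by linarith, by linarith⟩ ((a + b - u) / 2)
    ⟨by linarith, by linarith⟩
  rw [dist_circleExp, show ((a + b + u) / 2 - (a + b - u) / 2) / 2 = u / 2 by ring] at h2
  have h3 := Real.mul_le_sin (x := u / 2) (by linarith) (by linarith)
  have h4 := le_abs_self (Real.sin (u / 2))
  have h5 : 2 / Real.pi * (u / 2) = u / Real.pi := by ring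
  have h6 : Real.pi * r / 2 / Real.pi < u / Real.pi := div_lt_div_of_pos_right hu1 hπ
  have h7 : Real.pi * r / 2 / Real.pi = r / 2 := by field_simp
  linarith

section

variable {X : Type*} [MetricSpace X]

theorem arcLengthOver_le {γ : C(Circle, X)} {l : ℝ≥0}
    (hl : HasConstantSpeedOnWith (fun t : ℝ => γ (Circle.exp t)) univ l) {E : Set ℂ} {r : ℝ}
    (hr0 : 0 ≤ r) (hr : r < 2) (hE : ∀ x ∈ E, ∀ y ∈ E, dist x y ≤ r) :
    arcLengthOver γ E ≤ ENNReal.ofReal (l * (Real.pi * r / 2)) := by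
  refine iSup_le fun a => iSup_le fun b => iSup_le fun ⟨_, _, h⟩ => ?_
  have h1 := hl (mem_univ a) (mem_univ b)
  rw [univ_inter] at h1
  rw [h1]
  refine ENNReal.ofReal_le_ofReal (mul_le_mul_of_nonneg_left ?_ l.2)
  exact arc_length_le_of_dist_le hr0 hr fun s hs t ht => hE _ (h s hs) _ (h t ht)

/-- A grid partition of a loop, and a bound for its mesh. -/
theorem exists_loopPartition_mesh_le {N : ℕ} (hN : 0 < N) (Ψ : ℂ ≃ₜ ℂ)
    (hΨ : Ψ '' (Icc (0 : ℝ) N ×ℂ Icc (0 : ℝ) N) = Metric.closedBall 0 1) (γ : C(Circle, X))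
    (g : ℂ → X) (hg : ∀ z : Circle, g z = γ z) {c : ℝ≥0∞}
    (hdist : ∀ k : Fin N × Fin N, ∀ u ∈ gridPoints N, ∀ v ∈ gridPoints N,
      u ∈ gridCell k.1 k.2 → v ∈ gridCell k.1 k.2 → edist (g (Ψ u)) (g (Ψ v)) ≤ c)
    (harc : ∀ k : Fin N × Fin N, ∀ E ⊆ Ψ '' gridCell k.1 k.2, arcLengthOver γ E ≤ c) :
    ∃ Q : LoopPartition γ, Q.mesh ≤ 9 * c ∧ Q.base.numPieces = N * N := by
  let Q : LoopPartition γ :=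
    { base := gridPartition hN Ψ hΨ
      toFun := fun v => g v
      agrees := fun v z hz => by rw [← hz, hg] }
  refine ⟨Q, iSup_le fun i => ?_, rfl⟩
  have hbound : ∀ E : {E : Set ℂ // E ∈ Q.base.edges ∧ E ⊆ frontier (Q.base.disc i)},
      Q.edgeLength E ≤ c := by
    rintro ⟨E, -, hE⟩
    have hcl : IsClosed (Q.base.disc i) :=
      Ψ.isClosedMap _ (isClosed_gridCell _ _)
    have hEi : E ⊆ Q.base.disc i := hE.trans hcl.frontier_subset
    rw [LoopPartition.edgeLength]
    split_ifs with hsph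
    · exact harc (finProdFinEquiv.symm i) E hEi
    · refine Metric.ediam_le ?_
      rintro _ ⟨u, hu, rfl⟩ _ ⟨v, hv, rfl⟩
      -- All vertices in the closure of the edge are grid points of one closed cell, so the edge's
      -- end points need not be identified.
      have hu' : (u : ℂ) ∈ Q.base.disc i := closure_minimal hEi hcl hu
      have hv' : (v : ℂ) ∈ Q.base.disc i := closure_minimal hEi hcl hv
      obtain ⟨x, hx, hxu⟩ := gridPartition_vertices_subset hN Ψ hΨ u.2
      obtain ⟨y, hy, hyv⟩ := gridPartition_vertices_subset hN Ψ hΨ v.2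
      have hx' : x ∈ gridCell (finProdFinEquiv.symm i).1 (finProdFinEquiv.symm i).2 :=
        Ψ.injective.mem_set_image.1 (hxu ▸ hu')
      have hy' : y ∈ gridCell (finProdFinEquiv.symm i).1 (finProdFinEquiv.symm i).2 :=
        Ψ.injective.mem_set_image.1 (hyv ▸ hv')
      have := hdist _ x hx y hy hx' hy'
      rwa [hxu, hyv] at this
  calc Q.pieceLength i ≤ ∑' _ : {E : Set ℂ // E ∈ Q.base.edges ∧
        E ⊆ frontier (Q.base.disc i)}, c := ENNReal.tsum_le_tsum hbound
    _ = ENat.card {E : Set ℂ // E ∈ Q.base.edges ∧ E ⊆ frontier (Q.base.disc i)} * c :=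
        ENNReal.tsum_const c
    _ ≤ 9 * c := by
        gcongr
        exact_mod_cast card_edges_gridPartition_le hN Ψ hΨ i

end

/-- Arbitrarily fine grids on the disc. -/
theorem exists_fine_grid {Y : Type*} [PseudoMetricSpace Y] {F : ℂ → Y}
    (hF : ContinuousOn F (Metric.closedBall 0 1)) {η : ℝ} (hη : 0 < η) :
    ∃ N : ℕ, 0 < N ∧ ∃ Ψ : ℂ ≃ₜ ℂ,
      Ψ '' (Icc (0 : ℝ) N ×ℂ Icc (0 : ℝ) N) = Metric.closedBall 0 1 ∧
      ∀ k : Fin N × Fin N, ∀ u ∈ gridCell k.1 k.2, ∀ v ∈ gridCell k.1 k.2,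
        dist (Ψ u) (Ψ v) < η ∧ dist (F (Ψ u)) (F (Ψ v)) < η := by
  obtain ⟨Φ, hΦ⟩ := exists_homeomorph_image_rectangle (zero_lt_one' ℝ) (zero_lt_one' ℝ)
  have hcomp : IsCompact (Icc (0 : ℝ) 1 ×ℂ Icc (0 : ℝ) 1) := isCompact_Icc.reProdIm isCompact_Icc
  -- Uniform continuity of the pair controls the cells in the disc and their images under `F` with
  -- one `δ`.
  have hpair : ContinuousOn (fun z => (Φ z, F (Φ z))) (Icc (0 : ℝ) 1 ×ℂ Icc (0 : ℝ) 1) :=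
    Φ.continuous.continuousOn.prodMk
      (hF.comp Φ.continuous.continuousOn (mapsTo_iff_image_subset.2 hΦ.le))
  obtain ⟨δ, hδ, hδ'⟩ := Metric.uniformContinuousOn_iff.1
    (hcomp.uniformContinuousOn_of_continuous hpair) η hη
  -- After scaling by `1 / n`, points of a cell differ by at most `1 / n` in each coordinate, hence
  -- by at most `2 / n < δ`.
  obtain ⟨n, hn⟩ := exists_nat_gt (2 / δ)
  have hn0 : (0 : ℝ) < n := lt_trans (by positivity) hn
  have hnN : 0 < n := by exact_mod_cast hn0
  have hnC : ((n : ℂ)⁻¹) ≠ 0 := inv_ne_zero (by exact_mod_cast hnN.ne')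
  have hre : ∀ z : ℂ, ((n : ℂ)⁻¹ * z).re = z.re / n := fun z => by
    rw [inv_mul_eq_div, Complex.div_natCast_re]
  have him : ∀ z : ℂ, ((n : ℂ)⁻¹ * z).im = z.im / n := fun z => by
    rw [inv_mul_eq_div, Complex.div_natCast_im]
  have hscale : (fun z : ℂ => (n : ℂ)⁻¹ * z) '' (Icc (0 : ℝ) n ×ℂ Icc (0 : ℝ) n) =
      Icc (0 : ℝ) 1 ×ℂ Icc (0 : ℝ) 1 := by
    ext w
    constructor
    · rintro ⟨z, ⟨h1, h2⟩, rfl⟩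
      refine ⟨?_, ?_⟩
      · change ((n : ℂ)⁻¹ * z).re ∈ Icc (0 : ℝ) 1
        rw [hre]
        exact ⟨div_nonneg h1.1 hn0.le, (div_le_one hn0).2 h1.2⟩
      · change ((n : ℂ)⁻¹ * z).im ∈ Icc (0 : ℝ) 1
        rw [him]
        exact ⟨div_nonneg h2.1 hn0.le, (div_le_one hn0).2 h2.2⟩
    · rintro ⟨h1, h2⟩
      refine ⟨n * w, ⟨?_, ?_⟩, inv_mul_cancel_left₀ (by exact_mod_cast hnN.ne') w⟩
      · change ((n : ℂ) * w).re ∈ Icc (0 : ℝ) n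
        rw [show ((n : ℂ) * w).re = n * w.re by simp]
        exact ⟨mul_nonneg hn0.le h1.1, mul_le_of_le_one_right hn0.le h1.2⟩
      · change ((n : ℂ) * w).im ∈ Icc (0 : ℝ) n
        rw [show ((n : ℂ) * w).im = n * w.im by simp]
        exact ⟨mul_nonneg hn0.le h2.1, mul_le_of_le_one_right hn0.le h2.2⟩
  have hcell : ∀ k : Fin n × Fin n, gridCell k.1 k.2 ⊆ Icc (0 : ℝ) n ×ℂ Icc (0 : ℝ) n := by
    intro k
    rw [← iUnion_gridCell hnN]
    exact subset_iUnion (fun k : Fin n × Fin n => gridCell k.1 k.2) k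
  refine ⟨n, hnN, (Homeomorph.mulLeft₀ _ hnC).trans Φ, ?_, fun k u hu v hv => ?_⟩
  · rw [← hΦ, ← hscale, image_image]
    rfl
  · have hmem : ∀ w ∈ gridCell k.1 k.2, (n : ℂ)⁻¹ * w ∈ Icc (0 : ℝ) 1 ×ℂ Icc (0 : ℝ) 1 :=
      fun w hw => hscale ▸ mem_image_of_mem _ (hcell k hw)
    have hd : dist ((n : ℂ)⁻¹ * u) ((n : ℂ)⁻¹ * v) < δ := by
      have h1 : |(u - v).re| ≤ 1 := by
        rw [Complex.sub_re, abs_le]; constructor <;> linarith [hu.1.1, hu.1.2, hv.1.1, hv.1.2]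
      have h2 : |(u - v).im| ≤ 1 := by
        rw [Complex.sub_im, abs_le]; constructor <;> linarith [hu.2.1, hu.2.2, hv.2.1, hv.2.2]
      have h3 := Complex.norm_le_abs_re_add_abs_im (u - v)
      rw [dist_eq_norm, ← mul_sub, norm_mul, norm_inv, Complex.norm_natCast, inv_mul_lt_iff₀ hn0]
      rw [div_lt_iff₀ hδ] at hn
      linarith
    have := hδ' _ (hmem u hu) _ (hmem v hv) hd
    rw [Prod.dist_eq, max_lt_iff] at this
    exact this

/-! ### Discs bounded by null-homotopic loops -/

theorem exists_unitInterval_circleExp_eq (x : ℝ) :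
    ∃ t : unitInterval, Circle.exp (2 * Real.pi * t) = Circle.exp x := by
  have hπ := Real.pi_pos
  refine ⟨⟨Int.fract (x / (2 * Real.pi)), Int.fract_nonneg _, (Int.fract_lt_one _).le⟩, ?_⟩
  rw [Circle.exp_eq_exp]
  refine ⟨-⌊x / (2 * Real.pi)⌋, ?_⟩
  change 2 * Real.pi * Int.fract _ = _
  rw [Int.fract]
  push_cast
  field_simp
  ring

/-- A null-homotopic loop extends to the disc. -/
theorem exists_continuousOn_disc_of_homotopic_refl {Y : Type*} [TopologicalSpace Y] {y : Y}
    {p : Path y y} (h : p.Homotopic (Path.refl y)) :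
    ∃ F : ℂ → Y, ContinuousOn F (Metric.closedBall 0 1) ∧
      ∀ t : unitInterval, F (Circle.exp (2 * Real.pi * t)) = p t := by
  obtain ⟨H⟩ := h
  have hnorm : ∀ x : unitInterval × unitInterval,
      ‖((1 - x.1 : ℝ) : ℂ) * Circle.exp (2 * Real.pi * x.2)‖ = 1 - x.1 := fun x => by
    rw [norm_mul, Circle.norm_coe, mul_one, Complex.norm_real, Real.norm_of_nonneg]
    linarith [x.1.2.2]
  -- Polar coordinates, with the homotopy parameter running from the circle to the centre. As a
  -- continuous surjection from a compact space to a Hausdorff space, `q` is a quotient map. The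
  -- homotopy descends because it is constant at `s = 1` and fixes the base point at `t = 0, 1`.
  let q : unitInterval × unitInterval → Metric.closedBall (0 : ℂ) 1 := fun x =>
    ⟨((1 - x.1 : ℝ) : ℂ) * Circle.exp (2 * Real.pi * x.2), by
      rw [mem_closedBall_zero_iff, hnorm]
      linarith [x.1.2.1]⟩
  have hqc : Continuous q := by
    refine Continuous.subtype_mk (Continuous.mul (by fun_prop) ?_) _
    exact continuous_subtype_val.comp (Circle.exp.continuous.comp (by fun_prop))
  have hqs : Function.Surjective q := by
    rintro ⟨z, hz⟩
    rw [mem_closedBall_zero_iff] at hz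
    obtain ⟨t, ht⟩ := exists_unitInterval_circleExp_eq z.arg
    refine ⟨(⟨1 - ‖z‖, by linarith, by linarith [norm_nonneg z]⟩, t), Subtype.ext ?_⟩
    change ((1 - (1 - ‖z‖) : ℝ) : ℂ) * Circle.exp (2 * Real.pi * t) = z
    rw [ht, sub_sub_cancel, Circle.coe_exp, Complex.norm_mul_exp_arg_mul_I]
  have hquot : IsQuotientMap q := hqc.isClosedMap.isQuotientMap hqc hqs
  have hH0 : ∀ s, H (s, 0) = y := fun s => H.source s
  have hH1 : ∀ s, H (s, 1) = y := fun s => H.target s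
  have hwd : ∀ x x', q x = q x' → H x = H x' := by
    rintro ⟨s, t⟩ ⟨s', t'⟩ hq
    have hq' : ((1 - s : ℝ) : ℂ) * Circle.exp (2 * Real.pi * t) =
        ((1 - s' : ℝ) : ℂ) * Circle.exp (2 * Real.pi * t') := congrArg Subtype.val hq
    have hs : s = s' := by
      have := congrArg norm hq'
      rw [hnorm (s, t), hnorm (s', t')] at this
      exact Subtype.ext (by simpa using this)
    subst hs
    rcases eq_or_ne s 1 with rfl | hs
    · rw [H.apply_one, H.apply_one]; rfl
    have hs' : ((1 - s : ℝ) : ℂ) ≠ 0 := by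
      rw [Complex.ofReal_ne_zero, sub_ne_zero]
      exact fun h => hs (Subtype.ext h.symm)
    have hexp := Circle.coe_injective (mul_left_cancel₀ hs' hq')
    obtain ⟨m, hm⟩ := Circle.exp_eq_exp.1 hexp
    have hm' : (t : ℝ) = t' + m := by
      have h2 : 2 * Real.pi * t = 2 * Real.pi * (t' + m) := by rw [hm]; ring
      exact mul_left_cancel₀ Real.two_pi_pos.ne' h2
    have hm1 : (m : ℝ) ≤ 1 := by linarith [t.2.2, t'.2.1]
    have hm2 : (-1 : ℝ) ≤ m := by linarith [t.2.1, t'.2.2]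
    have hm1' : m ≤ 1 := by exact_mod_cast hm1
    have hm2' : -1 ≤ m := by exact_mod_cast hm2
    have hcases : m = -1 ∨ m = 0 ∨ m = 1 := by omega
    rcases hcases with rfl | rfl | rfl
    · have ht : t = 0 := Subtype.ext (by
        push_cast at hm'; change (t : ℝ) = 0; linarith [t.2.1, t'.2.2])
      have ht' : t' = 1 := Subtype.ext (by
        push_cast at hm'; change (t' : ℝ) = 1; linarith [t.2.1, t'.2.2])
      rw [ht, ht', hH0, hH1]
    · have ht : t = t' := Subtype.ext (by simpa using hm')
      rw [ht]
    · have ht : t = 1 := Subtype.ext (by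
        push_cast at hm'; change (t : ℝ) = 1; linarith [t.2.2, t'.2.1])
      have ht' : t' = 0 := Subtype.ext (by
        push_cast at hm'; change (t' : ℝ) = 0; linarith [t.2.2, t'.2.1])
      rw [ht, ht', hH0, hH1]
  let F' : Metric.closedBall (0 : ℂ) 1 → Y := fun z => H (Function.surjInv hqs z)
  have hF' : ∀ x, F' (q x) = H x := fun x => hwd _ _ (Function.surjInv_eq hqs _)
  have hF'c : Continuous F' := by
    rw [hquot.continuous_iff, show F' ∘ q = H from funext hF']
    exact H.continuous
  classical
  let F : ℂ → Y := fun z => if hz : z ∈ Metric.closedBall (0 : ℂ) 1 then F' ⟨z, hz⟩ else y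
  have hF : ∀ z : Metric.closedBall (0 : ℂ) 1, F z = F' z := fun z => dif_pos z.2
  refine ⟨F, ?_, fun t => ?_⟩
  · rw [continuousOn_iff_continuous_domRestrict, show (Metric.closedBall (0 : ℂ) 1).domRestrict F = F'
      from funext hF]
    exact hF'c
  · have h1 : ((q (0, t) : Metric.closedBall (0 : ℂ) 1) : ℂ) = Circle.exp (2 * Real.pi * t) := by
      change ((1 - ((0 : unitInterval) : ℝ) : ℝ) : ℂ) * _ = _
      simp
    rw [← h1, hF, hF', H.apply_zero]
    rfl

/-! ### Loops in the asymptotic cone -/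

section Cone

variable {X : Type*} [MetricSpace X] {ω : Ultrafilter ℕ} {e : ℕ → X} {d : ScalingSequence ω}

theorem BoundedSequence.dist_le {x y : BoundedSequence ω e d} {C : ℝ}
    (h : ∀ n, dist (x.1 n) (y.1 n) ≤ C * d.seq n) : dist x y ≤ C :=
  le_of_tendsto' (BoundedSequence.tendsto_dist x y) fun n => (div_le_iff₀ (d.pos n)).2 (h n)

theorem BoundedSequence.eventually_dist_lt {x y : BoundedSequence ω e d} {C : ℝ}
    (h : dist x y < C) : ∀ᶠ n in (ω : Filter ℕ), dist (x.1 n) (y.1 n) < C * d.seq n :=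
  ((BoundedSequence.tendsto_dist x y).eventually_lt_const h).mono fun n hn =>
    (div_lt_iff₀ (d.pos n)).1 hn

/-- The observation sequence. -/
def observationSequence (e : ℕ → X) (d : ScalingSequence ω) : BoundedSequence ω e d :=
  ⟨e, 1, .of_forall fun n => by simp⟩

variable {β : ℕ → C(Circle, X)} {L : ℝ}

/-- The sequence of the values of uniformly Lipschitz rescaled loops based at `e`. -/
def loopSequence (hL : ∀ n, ∀ s t : ℝ,
      dist (β n (Circle.exp s)) (β n (Circle.exp t)) ≤ L * |s - t| * d.seq n)
    (hβ : ∀ n, β n 1 = e n) (t : ℝ) : BoundedSequence ω e d :=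
  ⟨fun n => β n (Circle.exp t), L * |t - 0| + 1, .of_forall fun n => by
    have h := hL n t 0
    rw [Circle.exp_zero, hβ] at h
    exact ((div_le_iff₀ (d.pos n)).2 h).trans_lt (lt_add_one _)⟩

/-- A sequence of short loops has a limit loop that bounds a disc in the asymptotic cone, if short
loops in the cone are null-homotopic. -/
theorem exists_disc_in_cone {r : ℝ} (hr : 0 < r)
    (hnull : ∀ p : Path (SeparationQuotient.mk (observationSequence e d))
        (SeparationQuotient.mk (observationSequence e d)),
      (∀ t, dist (p t) (SeparationQuotient.mk (observationSequence e d)) ≤ r) →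
        p.Homotopic (Path.refl _))
    (hL : ∀ n, ∀ s t : ℝ, dist (β n (Circle.exp s)) (β n (Circle.exp t)) ≤
      r / (2 * Real.pi) * |s - t| * d.seq n)
    (hβ : ∀ n, β n 1 = e n) :
    ∃ F : ℂ → AsymptoticCone ω e d, ContinuousOn F (Metric.closedBall 0 1) ∧
      ∀ t : unitInterval, F (Circle.exp (2 * Real.pi * t)) =
        SeparationQuotient.mk (loopSequence hL hβ (2 * Real.pi * t)) := by
  have hπ := Real.two_pi_pos
  let a : ℝ → AsymptoticCone ω e d := fun t =>
    SeparationQuotient.mk (loopSequence hL hβ (2 * Real.pi * t))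
  -- Reparametrizing by `[0, 1]` turns the Lipschitz constant `r / (2π)` into `r`, which is what
  -- keeps the limit loop within `r` of its base point.
  have hdist : ∀ s t, dist (a s) (a t) ≤ r * |s - t| := fun s t => by
    rw [SeparationQuotient.dist_mk]
    refine BoundedSequence.dist_le fun n => (hL n _ _).trans_eq ?_
    rw [← mul_sub, abs_mul, abs_of_pos hπ]
    field_simp
  have hcont : Continuous a := by
    refine LipschitzWith.continuous (K := ⟨r, hr.le⟩) (.of_dist_le_mul fun s t => ?_)
    rw [Real.dist_eq]
    exact hdist s t
  have h0 : a 0 = SeparationQuotient.mk (observationSequence e d) :=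
    congrArg SeparationQuotient.mk (Subtype.ext (funext fun n => by
      simp [loopSequence, observationSequence, hβ]))
  have h1 : a 1 = SeparationQuotient.mk (observationSequence e d) :=
    congrArg SeparationQuotient.mk (Subtype.ext (funext fun n => by
      simp [loopSequence, observationSequence, hβ]))
  let p : Path (SeparationQuotient.mk (observationSequence e d))
      (SeparationQuotient.mk (observationSequence e d)) :=
    { toFun := fun t => a t
      continuous_toFun := hcont.comp continuous_subtype_val
      source' := by simpa using h0
      target' := by simpa using h1 }
  refine exists_continuousOn_disc_of_homotopic_refl (p := p) (hnull p fun t => ?_)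
  change dist (a t) _ ≤ r
  rw [← h0]
  refine (hdist t 0).trans ?_
  rw [sub_zero, abs_of_nonneg t.2.1]
  exact mul_le_of_le_one_right hr.le t.2.2

/-- A disc in the cone, restricted to the points of a fine grid, is the limit of maps to `X` that
extend the given loops. -/
theorem exists_grid_approximation {r : ℝ} (hr : 0 < r)
    (hnull : ∀ p : Path (SeparationQuotient.mk (observationSequence e d))
        (SeparationQuotient.mk (observationSequence e d)),
      (∀ t, dist (p t) (SeparationQuotient.mk (observationSequence e d)) ≤ r) →
        p.Homotopic (Path.refl _))
    (hL : ∀ n, ∀ s t : ℝ, dist (β n (Circle.exp s)) (β n (Circle.exp t)) ≤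
      r / (2 * Real.pi) * |s - t| * d.seq n)
    (hβ : ∀ n, β n 1 = e n) {η : ℝ} (hη : 0 < η) :
    ∃ N : ℕ, 0 < N ∧ ∃ Ψ : ℂ ≃ₜ ℂ,
      Ψ '' (Icc (0 : ℝ) N ×ℂ Icc (0 : ℝ) N) = Metric.closedBall 0 1 ∧
      (∀ k : Fin N × Fin N, ∀ u ∈ gridCell k.1 k.2, ∀ v ∈ gridCell k.1 k.2,
        dist (Ψ u) (Ψ v) < η) ∧
      ∀ᶠ n in (ω : Filter ℕ), ∃ g : ℂ → X, (∀ z : Circle, g z = β n z) ∧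
        ∀ k : Fin N × Fin N, ∀ u ∈ gridPoints N, ∀ v ∈ gridPoints N,
          u ∈ gridCell k.1 k.2 → v ∈ gridCell k.1 k.2 →
            dist (g (Ψ u)) (g (Ψ v)) < η * d.seq n := by
  obtain ⟨F, hF, hFβ⟩ := exists_disc_in_cone hr hnull hL hβ
  obtain ⟨N, hN, Ψ, hΨ, hfine⟩ := exists_fine_grid hF hη
  -- On the circle the representative is the sequence of values of `β n` itself: a loop partition
  -- must agree with the loop exactly, not just up to an error `o(d n)`.
  have hG : ∀ z : ℂ, ∃ G : BoundedSequence ω e d, SeparationQuotient.mk G = F z ∧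
      ∀ c : Circle, (c : ℂ) = z → ∀ n, G.1 n = β n c := by
    intro z
    by_cases hz : ∃ c : Circle, (c : ℂ) = z
    · obtain ⟨c, rfl⟩ := hz
      obtain ⟨t, ht⟩ := exists_unitInterval_circleExp_eq (Complex.arg c)
      rw [Circle.exp_arg] at ht
      refine ⟨loopSequence hL hβ (2 * Real.pi * t), ?_, fun c' hc' n => ?_⟩
      · rw [← hFβ, ht]
      · rw [Circle.coe_injective hc', ← ht]
        rfl
    · obtain ⟨G, hG⟩ := SeparationQuotient.surjective_mk (F z)
      exact ⟨G, hG, fun c hc => (hz ⟨c, hc⟩).elim⟩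
  choose G hGF hGβ using hG
  refine ⟨N, hN, Ψ, hΨ, fun k u hu v hv => (hfine k u hu v hv).1, ?_⟩
  have hev : ∀ᶠ n in (ω : Filter ℕ), ∀ k : Fin N × Fin N, ∀ u ∈ gridPoints N, ∀ v ∈ gridPoints N,
      u ∈ gridCell k.1 k.2 → v ∈ gridCell k.1 k.2 →
        dist ((G (Ψ u)).1 n) ((G (Ψ v)).1 n) < η * d.seq n := by
    rw [eventually_all]
    intro k
    rw [eventually_all_finite (finite_gridPoints N)]
    intro u _
    rw [eventually_all_finite (finite_gridPoints N)]
    intro v _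
    by_cases hu : u ∈ gridCell k.1 k.2
    · by_cases hv : v ∈ gridCell k.1 k.2
      · have h := (hfine k u hu v hv).2
        rw [← hGF, ← hGF, SeparationQuotient.dist_mk] at h
        exact (BoundedSequence.eventually_dist_lt h).mono fun n hn _ _ => hn
      · exact .of_forall fun n _ h => (hv h).elim
    · exact .of_forall fun n h => (hu h).elim
  exact hev.mono fun n hn => ⟨fun z => (G z).1 n, fun z => hGβ _ z rfl n, hn⟩

end Cone

/-! ### Coarse loop divisibility -/

section Divisibility

variable {X : Type*} [MetricSpace X]

theorem loopLength_eq {γ : C(Circle, X)} {l : ℝ≥0}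
    (hl : HasConstantSpeedOnWith (fun t : ℝ => γ (Circle.exp t)) univ l) :
    loopLength γ = ENNReal.ofReal (l * (2 * Real.pi)) := by
  have h := hl (mem_univ 0) (mem_univ (2 * Real.pi))
  rwa [univ_inter, sub_zero] at h

theorem dist_le_of_hasConstantSpeed {γ : C(Circle, X)} {l : ℝ≥0}
    (hl : HasConstantSpeedOnWith (fun t : ℝ => γ (Circle.exp t)) univ l) (s t : ℝ) :
    dist (γ (Circle.exp s)) (γ (Circle.exp t)) ≤ l * |s - t| := by
  wlog hst : s ≤ t generalizing s t
  · rw [dist_comm, abs_sub_comm]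
    exact this t s (le_of_not_ge hst)
  have h := hl (mem_univ s) (mem_univ t)
  rw [univ_inter] at h
  have h2 := eVariationOn.edist_le (fun t : ℝ => γ (Circle.exp t)) (left_mem_Icc.2 hst)
    (right_mem_Icc.2 hst)
  have h3 : 0 ≤ (l : ℝ) * (t - s) := mul_nonneg l.2 (sub_nonneg.2 hst)
  rw [h, edist_dist, ENNReal.ofReal_le_ofReal_iff h3] at h2
  rwa [abs_sub_comm, abs_of_nonneg (sub_nonneg.2 hst)]

theorem hasConstantSpeed_const (x : X) :
    HasConstantSpeedOnWith (fun t : ℝ => ContinuousMap.const Circle x (Circle.exp t)) univ 0 := by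
  intro s _ t _
  rw [NNReal.coe_zero, zero_mul, ENNReal.ofReal_zero]
  refine eVariationOn.constant_on ?_
  rintro _ ⟨_, _, rfl⟩ _ ⟨_, _, rfl⟩
  rfl

/-- A loop of length at most `b` whose divisibility is as bad as that of any loop of length between
`a` and `b`, up to the threshold `n`. -/
theorem exists_extremal_loop (x : X) {a b : ℝ} (hb : 0 ≤ b) (n : ℕ) :
    ∃ (α : C(Circle, X)) (l : ℝ≥0),
      HasConstantSpeedOnWith (fun t : ℝ => α (Circle.exp t)) univ l ∧ l * (2 * Real.pi) ≤ b ∧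
      ∀ K ≤ n, (∃ m : ℕ, (m : ℝ) ∈ Icc a b ∧ K < divisibility X m) →
        a < l * (2 * Real.pi) + 1 ∧ K < minPieces α (loopLength α / 2) := by
  classical
  set S : ℕ → Prop := fun K => ∃ m : ℕ, (m : ℝ) ∈ Icc a b ∧ K < divisibility X m with hS
  by_cases h : ∃ K ≤ n, S K
  · obtain ⟨K₀, hK₀, hSK₀⟩ := h
    -- A loop that beats the greatest admissible `K ≤ n` beats all smaller ones. The cutoff `n`
    -- makes a greatest `K` exist even where the divisibility is infinite.
    obtain ⟨m, hm, hlt⟩ := Nat.findGreatest_spec hK₀ hSK₀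
    rw [divisibility, lt_iSup_iff] at hlt
    obtain ⟨α, hα⟩ := hlt
    rw [lt_iSup_iff] at hα
    obtain ⟨⟨⟨l, hl⟩, h1, h2⟩, hlt⟩ := hα
    have hl0 : 0 ≤ l * (2 * Real.pi) := mul_nonneg l.2 Real.two_pi_pos.le
    rw [loopLength_eq hl] at h1 h2
    have h1' : (m : ℝ) < l * (2 * Real.pi) + 1 := by
      rw [← ENNReal.ofReal_natCast, ← ENNReal.ofReal_one, ← ENNReal.ofReal_add hl0 zero_le_one,
        ENNReal.ofReal_lt_ofReal_iff (by linarith)] at h1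
      exact h1
    have h2' : l * (2 * Real.pi) ≤ m := by
      rw [← ENNReal.ofReal_natCast, ENNReal.ofReal_le_ofReal_iff (Nat.cast_nonneg m)] at h2
      exact h2
    refine ⟨α, l, hl, h2'.trans hm.2, fun K hK hSK => ⟨hm.1.trans_lt h1', lt_of_le_of_lt ?_ hlt⟩⟩
    exact_mod_cast Nat.le_findGreatest hK hSK
  · refine ⟨.const _ x, 0, hasConstantSpeed_const x, by simpa using hb, fun K hK hSK => ?_⟩
    exact (h ⟨K, hK, hSK⟩).elim

/-- Divergence forces `ω` to be nonprincipal, since `d` is bounded on any finite set of indices. -/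
theorem ScalingSequence.eventually_ge {ω : Ultrafilter ℕ} (d : ScalingSequence ω) (K : ℕ) :
    ∀ᶠ n in (ω : Filter ℕ), K ≤ n := by
  obtain ⟨M, hM⟩ := ((Finset.range K).image d.seq).bddAbove
  refine (d.diverges M).mono fun n hn => ?_
  by_contra! hlt
  exact absurd (hM (Finset.mem_coe.2 (Finset.mem_image_of_mem _ (Finset.mem_range.2 hlt))))
    (not_le.2 hn)

theorem isCoarselyLoopDivisible_of_short_loops_null (hhom : IsHomogeneousSpace X) {ω : Ultrafilter ℕ}
    {d : ScalingSequence ω} {e : ℕ → X} {r : ℝ} (hr : 0 < r)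
    (hnull : ∀ p : Path (SeparationQuotient.mk (observationSequence e d))
        (SeparationQuotient.mk (observationSequence e d)),
      (∀ t, dist (p t) (SeparationQuotient.mk (observationSequence e d)) ≤ r) →
        p.Homotopic (Path.refl _)) :
    IsCoarselyLoopDivisible X ω d r := by
  rintro δ ⟨hδ, -⟩
  have hπ := Real.pi_pos
  by_contra! hcon
  choose α l hspeed hlen hext using fun n => exists_extremal_loop (e n) (a := δ * d.seq n)
    (b := r * d.seq n) (mul_nonneg hr.le (d.pos n).le) n
  choose f hf using fun n => hhom (α n 1) (e n)
  -- If the bad indices were not `ω`-large, their complement would be, and `hcon` would find a bad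
  -- index in it.
  have hbad : ∀ K : ℕ, ∀ᶠ n in (ω : Filter ℕ),
      ∃ m : ℕ, (m : ℝ) ∈ Icc (δ * d.seq n) (r * d.seq n) ∧ K < divisibility X m := by
    intro K
    by_contra hK
    rw [Ultrafilter.eventually_not.symm] at hK
    obtain ⟨n, hn, m, hm, hlt⟩ := hcon _ hK K
    exact hn ⟨m, hm, hlt⟩
  let β : ℕ → C(Circle, X) := fun n => (⟨f n, (f n).continuous⟩ : C(X, X)).comp (α n)
  have hL : ∀ n, ∀ s t : ℝ, dist (β n (Circle.exp s)) (β n (Circle.exp t)) ≤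
      r / (2 * Real.pi) * |s - t| * d.seq n := fun n s t => by
    have h1 : dist (β n (Circle.exp s)) (β n (Circle.exp t)) =
      dist (α n (Circle.exp s)) (α n (Circle.exp t)) := (f n).dist_eq _ _
    have h2 : (l n : ℝ) ≤ r * d.seq n / (2 * Real.pi) :=
      (le_div_iff₀ Real.two_pi_pos).2 (hlen n)
    rw [h1]
    calc _ ≤ l n * |s - t| := dist_le_of_hasConstantSpeed (hspeed n) s t
      _ ≤ r * d.seq n / (2 * Real.pi) * |s - t| := by gcongr
      _ = _ := by ring
  -- The mesh is at most `9 c d_n = δ d_n / 8`. Since `d_n > 2 / δ`, the length exceeds `δ d_n - 1 >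
  -- δ d_n / 2`, so half of it exceeds `δ d_n / 4`.
  set c : ℝ := δ / 72 with hc
  have hc0 : 0 < c := by positivity
  obtain ⟨N, hN, Ψ, hΨ, hfine, hev⟩ := exists_grid_approximation hr hnull hL hf
    (η := min 1 (min c (c / r))) (by positivity)
  -- The bound `1` keeps chords below the diameter `2` of the circle, `c` controls distances between
  -- grid points, and `c / r` controls boundary arcs, whose length is at most `r η d_n / 4`.
  set η : ℝ := min 1 (min c (c / r)) with hη
  have hη0 : 0 < η := by positivity
  have hη1 : η ≤ 1 := min_le_left _ _
  have hηc : η ≤ c := (min_le_right _ _).trans (min_le_left _ _)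
  have hηr : r * η ≤ c := by
    rw [← le_div_iff₀' hr]
    exact (min_le_right _ _).trans (min_le_right _ _)
  -- The grid size is now fixed, so `K = N * N` can be used; `n ≥ N * N` puts it below the cutoff of
  -- the extremal loop.
  obtain ⟨n, ⟨g, hg, hgd⟩, hn, hdn, hnN⟩ := (hev.and ((hbad (N * N)).and
    ((d.diverges (2 / δ)).and (d.eventually_ge (N * N))))).exists
  obtain ⟨hlong, hmin⟩ := hext n (N * N) hnN hn
  have hd := d.pos n
  rw [div_lt_iff₀ hδ] at hdn
  obtain ⟨Q, hQ, hQN⟩ := exists_loopPartition_mesh_le hN Ψ hΨ (α n) (fun z => (f n).symm (g z))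
    (fun z => by rw [hg]; exact (f n).symm_apply_apply _) (c := ENNReal.ofReal (c * d.seq n))
    (fun k u hu v hv huk hvk => by
      rw [(f n).symm.isometry.edist_eq, edist_dist]
      refine ENNReal.ofReal_le_ofReal ((hgd k u hu v hv huk hvk).le.trans ?_)
      gcongr)
    (fun k E hE => by
      refine (arcLengthOver_le (hspeed n) hη0.le (by linarith) fun x hx y hy => ?_).trans
        (ENNReal.ofReal_le_ofReal ?_)
      · obtain ⟨u, hu, rfl⟩ := hE hx
        obtain ⟨v, hv, rfl⟩ := hE hy
        exact (hfine k u hu v hv).le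
      · have h1 := mul_le_mul_of_nonneg_right (hlen n) hη0.le
        have h2 := mul_le_mul_of_nonneg_right hηr hd.le
        have h3 : 0 ≤ c * d.seq n := by positivity
        nlinarith)
  have hmesh : Q.mesh < loopLength (α n) / 2 := by
    refine hQ.trans_lt ?_
    rw [loopLength_eq (hspeed n), show (9 : ℝ≥0∞) = ENNReal.ofReal 9 by simp,
      show (2 : ℝ≥0∞) = ENNReal.ofReal 2 by simp, ← ENNReal.ofReal_mul (by norm_num),
      ← ENNReal.ofReal_div_of_pos two_pos]
    refine (ENNReal.ofReal_lt_ofReal_iff_of_nonneg (by positivity)).2 ?_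
    rw [hc]
    nlinarith
  have hle : minPieces (α n) (loopLength (α n) / 2) ≤ (N * N : ℕ) := by
    rw [← hQN]
    exact iInf₂_le Q hmesh
  exact absurd (hmin.trans_le hle) (lt_irrefl _)

end Divisibility

end CoarseLoop
end

theorem mainTheorem6 {X : Type*} [MetricSpace X] [CompleteSpace X]
    (hgeo : CoarseLoop.IsGeodesicSpace X) (hhom : CoarseLoop.IsHomogeneousSpace X)
    (ω : Ultrafilter ℕ) (d : CoarseLoop.ScalingSequence ω) (e : ℕ → X)
    (hcone : CoarseLoop.IsSemilocallySimplyConnected (CoarseLoop.AsymptoticCone ω e d)) :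
    ∃ ε : ℝ, 0 < ε ∧ CoarseLoop.IsCoarselyLoopDivisible X ω d ε := by
  obtain ⟨U, hU, hnull⟩ := hcone (SeparationQuotient.mk (CoarseLoop.observationSequence e d))
  obtain ⟨r, hr, hrU⟩ := Metric.nhds_basis_closedBall.mem_iff.1 hU
  refine ⟨r, hr, CoarseLoop.isCoarselyLoopDivisible_of_short_loops_null hhom hr fun p hp => hnull p ?_⟩
  rintro _ ⟨t, rfl⟩
  exact hrU (Metric.mem_closedBall.2 (hp t))
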